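/- Let $n\ge 0$ be an integer and let $\alpha,\beta\in\mathbb R$ with $\alpha,\beta,\alpha+\beta\notin\mathbb Z$. Let $$P_n^{(\alpha,\beta)}(z)=2^{-n}\sum_{k=0}^n\binom{n+\alpha}{n-k}\binom{n+\beta}{k}(z-1)^k(z+1)^{n-k}$$ be the Jacobi polynomial. Suppose that (at least) two of the conditions $\alpha>-1$, $\beta>-1$, $2n+\alpha+\beta<0$ hold, and let $\Delta\subset\mathbb R$ be a set corresponding to two conditions that hold: - $\Delta=[-1,1]$ if $\alpha>-1$ and $\beta>-1$; - $\Delta=(-\infty,-1]$ if $2n+\alpha+\beta<0$ and $\beta>-1$; - $\Delta=[1,+\infty)$ if $2n+\alpha+\beta<0$ and $\alpha>-1$. Let $w$ be any branch of $(1-t)^\alpha(1+t)^\beta=\exp[\alpha\log(1-t)+\beta\log(1+t)]$ that is continuous on the interior of $\Delta$. Then $P_n^{(\alpha,\beta)}$ has degree exactly $n$, and the following hold for polynomials with complex coefficients. 1. For every polynomial $q$ of degree at most $n-1$ (only $q=0$ if $n=0$), the function $q\,P_n^{(\alpha,\beta)}w$ is integrable on $\Delta$ and $\int_\Delta q(t)P_n^{(\alpha,\beta)}(t)w(t)\,dt=0$.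 2. For every polynomial $q$ of degree exactly $n$: if $\Delta=[-1,1]$ or $2n+\alpha+\beta<-1$, then $q\,P_n^{(\alpha,\beta)}w$ is integrable on $\Delta$ and $\int_\Delta q(t)P_n^{(\alpha,\beta)}(t)w(t)\,dt\neq0$; if $\Delta$ is unbounded and $-1<2n+\alpha+\beta<0$, then this integral diverges (both as a Lebesgue integral and as the limit of the integrals over $\Delta\cap[-R,R]$ as $R\to\infty$). 3. The orthogonality conditions characterize $P_n^{(\alpha,\beta)}$ up to a constant factor: a polynomial $p$ of degree at most $n$ satisfies, for every polynomial $q$ of degree at most $n-1$, that $q\,p\,w$ is integrable on $\Delta$ and $\int_\Delta q(t)p(t)w(t)\,dt=0$, if and only if $p=c\,P_n^{(\alpha,\beta)}$ for some $c\in\mathbb C$. -/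

import Mathlib

open Polynomial Filter Topology MeasureTheory

/-- The Jacobi polynomial `P_n^{(α,β)}(z) = 2⁻ⁿ ∑ₖ binom(n+α, n-k) binom(n+β, k) (z-1)^k (z+1)^(n-k)`
for arbitrary complex parameters, with generalized binomial coefficients. -/
noncomputable def jacobiP (n : ℕ) (α β : ℂ) : ℂ[X] :=
  C (((2 : ℂ) ^ n)⁻¹) * ∑ k ∈ Finset.range (n + 1),
    C (Ring.choose ((n : ℂ) + α) (n - k) * Ring.choose ((n : ℂ) + β) k) *
      ((X - 1) ^ k * (X + 1) ^ (n - k))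

/-- `w` is, on the interior of the real set `Δ`, a continuous branch of the multivalued function
`(1 - t)^α (1 + t)^β = exp (α log (1 - t) + β log (1 + t))`: it is continuous there, and each value
is obtained from some complex logarithm `a` of `1 - t` and some complex logarithm `b` of
`1 + t`. -/
def IsJacobiWeightBranch (α β : ℝ) (Δ : Set ℝ) (w : ℝ → ℂ) : Prop :=
  ContinuousOn w (interior Δ) ∧
    ∀ t ∈ interior Δ, ∃ a b : ℂ,
      Complex.exp a = 1 - (t : ℂ) ∧ Complex.exp b = 1 + (t : ℂ) ∧
        w t = Complex.exp ((α : ℂ) * a + (β : ℂ) * b)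

/-- The function `t ↦ q(t) p(t) w(t)` on the real line. -/
noncomputable def orthIntegrand (w : ℝ → ℂ) (q p : ℂ[X]) (t : ℝ) : ℂ :=
  q.eval (t : ℂ) * p.eval (t : ℂ) * w t

/-- The integral of `f` over `Δ` diverges: `f` is not Lebesgue integrable on `Δ`, and the truncated
integrals over `Δ ∩ [-R, R]` have no finite limit as `R → ∞` either. -/
def IntegralDiverges (f : ℝ → ℂ) (Δ : Set ℝ) : Prop :=
  ¬ IntegrableOn f Δ ∧
    ¬ ∃ L : ℂ, Tendsto (fun R : ℝ => ∫ t in Δ ∩ Set.Icc (-R) R, f t) atTop (𝓝 L)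

/-- The admissible choices of the real set `Δ`, one for each pair among the three conditions
`α > -1`, `β > -1`, `2n + α + β < 0`. -/
def IsOrthogonalitySet (n : ℕ) (α β : ℝ) (Δ : Set ℝ) : Prop :=
  (-1 < α ∧ -1 < β ∧ Δ = Set.Icc (-1) 1) ∨
    (2 * (n : ℝ) + α + β < 0 ∧ -1 < β ∧ Δ = Set.Iic (-1)) ∨
    (2 * (n : ℝ) + α + β < 0 ∧ -1 < α ∧ Δ = Set.Ici 1)

/-! On the interior of `Δ` a branch `w` is a nonzero constant times `|1 - t|^α |1 + t|^β`
(`IsJacobiWeightBranch.exists_eq_const_mul`), so everything reduces to this positive weight.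

Orthogonality is integration by parts, by induction on `n` with both parameters shifted by one. The
operator `R` = `jacobiRaise` satisfies `R P_n^(α+1,β+1) = -2(n+1) P_{n+1}^(α,β)`
(`jacobiRaise_jacobiP`) and `R(qP) = q R(P) + q' (1 - X²) P`. The weighted integral of `R(qP)` is
zero because the boundary terms vanish (`IsOrthogonalitySet.integral_jacobiRaise`). Up to a fixed
sign, `1 - t²` times the weight is the shifted weight, so the `q'` term vanishes by induction.

The rest uses positivity of `∫ |f|²` against the weight. Any `q` of degree `n` is `a * conj P + r`
with `a ≠ 0` and `deg r < n`, so its integral against `P` is governed by that of `|P|²`, whose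
integrand grows like `|t|^(2n+α+β)` at infinity. For uniqueness, write `p = a P + r` and test
against `conj r`. -/

/-! ### Algebraic properties of Jacobi polynomials -/

theorem ringChoose_succ_mul (x : ℂ) (j : ℕ) :
    Ring.choose x (j + 1) * (j + 1 : ℂ) = Ring.choose x j * (x - j) := by
  have h1 : ((j + 1).factorial : ℂ) * Ring.choose x (j + 1)
      = (descPochhammer ℤ (j + 1)).smeval x := by
    rw [Ring.descPochhammer_eq_factorial_smul_choose, nsmul_eq_mul]
  have h2 : (j.factorial : ℂ) * Ring.choose x j = (descPochhammer ℤ j).smeval x := by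
    rw [Ring.descPochhammer_eq_factorial_smul_choose, nsmul_eq_mul]
  have h3 : (descPochhammer ℤ (j + 1)).smeval x = (descPochhammer ℤ j).smeval x * (x - j) := by
    rw [descPochhammer_succ_right, smeval_mul, smeval_sub, smeval_X, smeval_natCast]
    simp
  rw [← h1, ← h2, Nat.factorial_succ] at h3
  have hf : (j.factorial : ℂ) ≠ 0 := Nat.cast_ne_zero.2 j.factorial_ne_zero
  apply mul_left_cancel₀ hf
  push_cast at h3
  linear_combination h3

theorem ringChoose_ne_zero {x : ℂ} (hx : ∀ m : ℤ, x ≠ m) (j : ℕ) : Ring.choose x j ≠ 0 := by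
  induction j with
  | zero => simp
  | succ j ih =>
    intro h
    have h1 := ringChoose_succ_mul x j
    rw [h, zero_mul] at h1
    rcases mul_eq_zero.1 h1.symm with h2 | h2
    · exact ih h2
    · exact hx j (by simpa using sub_eq_zero.1 h2)

theorem natDegree_jacobiP_summand_le {n k : ℕ} (hk : k ≤ n) :
    ((X - 1 : ℂ[X]) ^ k * (X + 1) ^ (n - k)).natDegree ≤ n := by
  have h1 : (X - 1 : ℂ[X]).natDegree ≤ 1 := by compute_degree
  have h2 : (X + 1 : ℂ[X]).natDegree ≤ 1 := by compute_degree
  have := natDegree_mul_le_of_le (natDegree_pow_le_of_le k h1) (natDegree_pow_le_of_le (n - k) h2)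
  omega

theorem coeff_jacobiP_summand {n k : ℕ} (hk : k ≤ n) :
    ((X - 1 : ℂ[X]) ^ k * (X + 1) ^ (n - k)).coeff n = 1 := by
  have m1 : (X - 1 : ℂ[X]).Monic := by simpa using monic_X_sub_C (1 : ℂ)
  have m2 : (X + 1 : ℂ[X]).Monic := by simpa using monic_X_add_C (1 : ℂ)
  have d1 : (X - 1 : ℂ[X]).natDegree = 1 := by simpa using natDegree_X_sub_C (1 : ℂ)
  have d2 : (X + 1 : ℂ[X]).natDegree = 1 := by simpa using natDegree_X_add_C (1 : ℂ)
  have m := (m1.pow k).mul (m2.pow (n - k))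
  have d : ((X - 1 : ℂ[X]) ^ k * (X + 1) ^ (n - k)).natDegree = n := by
    rw [(m1.pow k).natDegree_mul (m2.pow _), m1.natDegree_pow, m2.natDegree_pow, d1, d2]
    omega
  have := m.coeff_natDegree
  rwa [d] at this

theorem natDegree_jacobiP_le (n : ℕ) (α β : ℂ) : (jacobiP n α β).natDegree ≤ n := by
  unfold jacobiP
  refine (natDegree_C_mul_le _ _).trans (natDegree_sum_le_of_forall_le _ _ fun k hk => ?_)
  exact (natDegree_C_mul_le _ _).trans
    (natDegree_jacobiP_summand_le (Nat.lt_succ_iff.1 (Finset.mem_range.1 hk)))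

/-- Each summand is a scalar times a monic polynomial of degree `n`, so the coefficient is a
Vandermonde convolution. -/
theorem coeff_jacobiP (n : ℕ) (α β : ℂ) :
    (jacobiP n α β).coeff n = ((2 : ℂ) ^ n)⁻¹ * Ring.choose ((n + α) + (n + β)) n := by
  unfold jacobiP
  rw [coeff_C_mul, finsetSum_coeff, add_comm ((n : ℂ) + α),
    Ring.add_choose_eq n (Commute.all _ _), Finset.Nat.sum_antidiagonal_eq_sum_range_succ_mk]
  congr 1
  refine Finset.sum_congr rfl fun k hk => ?_
  rw [coeff_C_mul, coeff_jacobiP_summand (Nat.lt_succ_iff.1 (Finset.mem_range.1 hk)), mul_one,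
    mul_comm]

theorem degree_jacobiP (n : ℕ) {α β : ℂ} (h : ∀ m : ℤ, α + β ≠ m) :
    (jacobiP n α β).degree = n := by
  refine degree_eq_of_le_of_coeff_ne_zero (natDegree_le_iff_degree_le.1 (natDegree_jacobiP_le n α β))
    ?_
  rw [coeff_jacobiP]
  refine mul_ne_zero (by simp) (ringChoose_ne_zero (fun m hm => h (m - 2 * n) ?_) n)
  push_cast
  linear_combination hm

/-- The polynomial `g` with
`d/dt [f(t) (1 - t)^(α + 1) (1 + t)^(β + 1)] = g(t) (1 - t)^α (1 + t)^β`. -/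
noncomputable def jacobiRaise (α β : ℂ) (f : ℂ[X]) : ℂ[X] :=
  (1 - X ^ 2) * derivative f + (C (β + 1) * (1 - X) - C (α + 1) * (1 + X)) * f

theorem natDegree_jacobiRaise_le (α β : ℂ) (f : ℂ[X]) :
    (jacobiRaise α β f).natDegree ≤ f.natDegree + 1 := by
  unfold jacobiRaise
  refine natDegree_add_le_of_degree_le ?_ ?_
  · rcases Nat.eq_zero_or_pos f.natDegree with h | h
    · rw [derivative_of_natDegree_zero h]; simp
    · have h1 : (1 - X ^ 2 : ℂ[X]).natDegree ≤ 2 := by compute_degree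
      have := natDegree_mul_le_of_le h1 (natDegree_derivative_le f)
      omega
  · have h1 : (C (β + 1) * (1 - X) - C (α + 1) * (1 + X) : ℂ[X]).natDegree ≤ 1 := by
      compute_degree
    have := natDegree_mul_le_of_le h1 (le_refl f.natDegree)
    omega

theorem jacobiRaise_mul (α β : ℂ) (q f : ℂ[X]) :
    jacobiRaise α β (q * f) = q * jacobiRaise α β f + derivative q * ((1 - X ^ 2) * f) := by
  unfold jacobiRaise
  rw [derivative_mul]
  ring

theorem jacobiRaise_C_mul (α β c : ℂ) (f : ℂ[X]) :
    jacobiRaise α β (C c * f) = C c * jacobiRaise α β f := by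
  simp [jacobiRaise_mul]

theorem jacobiRaise_sum (α β : ℂ) {ι : Type*} (s : Finset ι) (f : ι → ℂ[X]) :
    jacobiRaise α β (∑ i ∈ s, f i) = ∑ i ∈ s, jacobiRaise α β (f i) := by
  simp only [jacobiRaise, derivative_sum, Finset.mul_sum, Finset.sum_add_distrib]

/-- Since `1 - X² = -(X - 1)(X + 1)`, differentiation followed by this factor only multiplies the
powers by their exponents. -/
theorem jacobiRaise_summand (α β : ℂ) (k l : ℕ) :
    jacobiRaise α β ((X - 1) ^ k * (X + 1) ^ l) =
      -(C (k + α + 1) * ((X - 1) ^ k * (X + 1) ^ (l + 1))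
        + C (l + β + 1) * ((X - 1) ^ (k + 1) * (X + 1) ^ l)) := by
  have h1 : (X - 1) * derivative ((X - 1 : ℂ[X]) ^ k) = C (k : ℂ) * (X - 1) ^ k := by
    cases k with
    | zero => simp
    | succ k => simp [derivative_pow]; ring
  have h2 : (X + 1) * derivative ((X + 1 : ℂ[X]) ^ l) = C (l : ℂ) * (X + 1) ^ l := by
    cases l with
    | zero => simp
    | succ k => simp [derivative_pow]; ring
  unfold jacobiRaise
  rw [derivative_mul]
  simp only [C_add, C_1] at *
  linear_combination (-(X + 1) ^ (l + 1)) * h1 - (X - 1) ^ (k + 1) * h2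

/-- The raising relation between Jacobi polynomials of consecutive degrees. -/
theorem jacobiRaise_jacobiP (n : ℕ) (α β : ℂ) :
    jacobiRaise α β (jacobiP n (α + 1) (β + 1)) =
      C (-2 * (n + 1 : ℂ)) * jacobiP (n + 1) α β := by
  set x : ℂ := ((n + 1 : ℕ) : ℂ) + α with hx
  set y : ℂ := ((n + 1 : ℕ) : ℂ) + β with hy
  have hx' : (n : ℂ) + (α + 1) = x := by rw [hx]; push_cast; ring
  have hy' : (n : ℂ) + (β + 1) = y := by rw [hy]; push_cast; ring
  unfold jacobiP
  rw [hx', hy', jacobiRaise_C_mul, jacobiRaise_sum]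
  have key : ∑ k ∈ Finset.range (n + 1), jacobiRaise α β
        (C (Ring.choose x (n - k) * Ring.choose y k) * ((X - 1) ^ k * (X + 1) ^ (n - k))) =
      C (-(n + 1 : ℂ)) * ∑ k ∈ Finset.range (n + 1 + 1),
        C (Ring.choose x (n + 1 - k) * Ring.choose y k) *
          ((X - 1) ^ k * (X + 1) ^ (n + 1 - k)) := by
    -- Absorption `(j + 1) binom(x, j + 1) = (x - j) binom(x, j)`: with `l = n - k`, `x - l = k + α
    -- + 1` and `y - k = l + β + 1`.
    have e1 : ∑ k ∈ Finset.range (n + 1), jacobiRaise α β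
          (C (Ring.choose x (n - k) * Ring.choose y k) * ((X - 1) ^ k * (X + 1) ^ (n - k))) =
        ∑ k ∈ Finset.range (n + 1),
          (C (-((n + 1 - k : ℂ) * (Ring.choose x (n + 1 - k) * Ring.choose y k))) *
            ((X - 1) ^ k * (X + 1) ^ (n + 1 - k)) +
          C (-((k + 1 : ℂ) * (Ring.choose x (n - k) * Ring.choose y (k + 1)))) *
            ((X - 1) ^ (k + 1) * (X + 1) ^ (n - k))) := by
      refine Finset.sum_congr rfl fun k hk => ?_
      obtain ⟨l, rfl⟩ := Nat.exists_eq_add_of_le (Nat.lt_succ_iff.1 (Finset.mem_range.1 hk))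
      have s1 : k + l - k = l := by omega
      have s2 : k + l + 1 - k = l + 1 := by omega
      rw [jacobiRaise_C_mul, s1, s2, jacobiRaise_summand]
      have c1 := ringChoose_succ_mul x l
      have c2 := ringChoose_succ_mul y k
      have d1 : (((k + l : ℕ) : ℂ) + 1 - k) * (Ring.choose x (l + 1) * Ring.choose y k) =
          (Ring.choose x l * Ring.choose y k) * (k + α + 1) := by
        rw [hx] at c1 ⊢
        push_cast at c1 ⊢
        linear_combination Ring.choose y k * c1
      have d2 : ((k : ℂ) + 1) * (Ring.choose x l * Ring.choose y (k + 1)) =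
          (Ring.choose x l * Ring.choose y k) * (l + β + 1) := by
        rw [hy] at c2 ⊢
        push_cast at c2 ⊢
        linear_combination Ring.choose x l * c2
      rw [d1, d2]
      simp only [C_neg, C_mul]
      ring
    rw [e1, Finset.sum_add_distrib, Finset.mul_sum]
    -- Both sums extend to a common range because the added terms carry a zero factor: `n + 1 - k`
    -- at `k = n + 1` here, `k` at `k = 0` after the shift in `e3`. The two factors then add up to
    -- `n + 1`.
    have e2 : ∑ k ∈ Finset.range (n + 1),
          C (-((n + 1 - k : ℂ) * (Ring.choose x (n + 1 - k) * Ring.choose y k))) *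
            ((X - 1) ^ k * (X + 1) ^ (n + 1 - k)) =
        ∑ k ∈ Finset.range (n + 1 + 1),
          C (-((n + 1 - k : ℂ) * (Ring.choose x (n + 1 - k) * Ring.choose y k))) *
            ((X - 1) ^ k * (X + 1) ^ (n + 1 - k)) := by
      rw [Finset.sum_range_succ _ (n + 1)]
      simp
    have e3 : ∑ k ∈ Finset.range (n + 1),
          C (-((k + 1 : ℂ) * (Ring.choose x (n - k) * Ring.choose y (k + 1)))) *
            ((X - 1) ^ (k + 1) * (X + 1) ^ (n - k)) =
        ∑ k ∈ Finset.range (n + 1 + 1),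
          C (-((k : ℂ) * (Ring.choose x (n + 1 - k) * Ring.choose y k))) *
            ((X - 1) ^ k * (X + 1) ^ (n + 1 - k)) := by
      rw [Finset.sum_range_succ' _ (n + 1)]
      simp
    rw [e2, e3, ← Finset.sum_add_distrib]
    refine Finset.sum_congr rfl fun k _ => ?_
    rw [← add_mul, ← C_add, ← mul_assoc (C _) (C _), ← C_mul]
    congr 2
    ring
  rw [key, ← mul_assoc, ← mul_assoc, ← C_mul, ← C_mul]
  congr 2
  have : (2 : ℂ) ^ n ≠ 0 := by simp
  field_simp
  ring

/-- Every polynomial of degree at most `n` is a multiple of a given polynomial of degree `n` up to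
terms of lower degree. -/
theorem exists_eq_C_mul_add {n : ℕ} {A q : ℂ[X]} (hA : A.degree = n) (hq : q.degree ≤ n) :
    ∃ (a : ℂ) (r : ℂ[X]), q = C a * A + r ∧ r.degree < n := by
  refine ⟨q.coeff n / A.coeff n, q - C (q.coeff n / A.coeff n) * A, by ring, ?_⟩
  have hA0 : A.coeff n ≠ 0 := coeff_ne_zero_of_eq_degree hA
  rw [degree_lt_iff_coeff_zero]
  intro m hm
  rcases hm.eq_or_lt with rfl | hm
  · simp [hA0]
  · have hm' : (n : WithBot ℕ) < m := by exact_mod_cast hm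
    rw [coeff_sub, coeff_C_mul, coeff_eq_zero_of_degree_lt (hq.trans_lt hm'),
      coeff_eq_zero_of_degree_lt (hA.le.trans_lt hm')]
    simp

theorem eval_map_conj_ofReal (f : ℂ[X]) (t : ℝ) :
    (f.map (starRingEnd ℂ)).eval (t : ℂ) = starRingEnd ℂ (f.eval (t : ℂ)) := by
  have := (eval₂_hom (p := f) (starRingEnd ℂ) (t : ℂ))
  rwa [Complex.conj_ofReal, eval₂_eq_eval_map] at this

/-! ### The positive Jacobi weight -/

/-- The positive weight `|1 - t|^α |1 + t|^β`. -/
noncomputable def jacobiAbsWeight (α β t : ℝ) : ℝ := |1 - t| ^ α * |1 + t| ^ β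

/-- A polynomial times the positive weight `|1 - t|^α |1 + t|^β`. -/
noncomputable def jacobiWeighted (α β : ℝ) (f : ℂ[X]) (t : ℝ) : ℂ :=
  f.eval (t : ℂ) * (jacobiAbsWeight α β t : ℂ)

theorem jacobiAbsWeight_nonneg (α β t : ℝ) : 0 ≤ jacobiAbsWeight α β t := by
  unfold jacobiAbsWeight; positivity

theorem jacobiAbsWeight_pos (α β : ℝ) {t : ℝ} (h1 : t ≠ 1) (h2 : t ≠ -1) :
    0 < jacobiAbsWeight α β t := by
  have h3 : 0 < |1 - t| := abs_pos.2 (sub_ne_zero.2 h1.symm)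
  have h4 : 0 < |1 + t| := abs_pos.2 (by contrapose! h2; linarith)
  unfold jacobiAbsWeight; positivity

theorem jacobiWeighted_neg (α β : ℝ) (f : ℂ[X]) (t : ℝ) :
    jacobiWeighted α β f (-t) = jacobiWeighted β α (f.comp (-X)) t := by
  simp only [jacobiWeighted, jacobiAbsWeight, eval_comp, eval_neg, eval_X, Complex.ofReal_neg,
    sub_neg_eq_add, ← sub_eq_add_neg]
  rw [mul_comm (|1 + t| ^ α)]

theorem natDegree_comp_neg_X (f : ℂ[X]) : (f.comp (-X)).natDegree = f.natDegree := by
  rw [natDegree_comp]; simp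

theorem jacobiRaise_comp_neg_X (α β : ℂ) (f : ℂ[X]) :
    (jacobiRaise α β f).comp (-X) = -jacobiRaise β α (f.comp (-X)) := by
  simp only [jacobiRaise, derivative_comp, add_comp, mul_comp, sub_comp, C_comp, X_comp, one_comp,
    pow_comp, derivative_neg, derivative_X]
  ring

theorem continuousAt_jacobiAbsWeight {α β t : ℝ} (h1 : t ≠ 1 ∨ 0 ≤ α) (h2 : t ≠ -1 ∨ 0 ≤ β) :
    ContinuousAt (jacobiAbsWeight α β) t := by
  refine ContinuousAt.mul ?_ ?_
  · refine ContinuousAt.rpow_const (by fun_prop) ?_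
    refine h1.imp_left fun h => abs_ne_zero.2 (sub_ne_zero.2 h.symm)
  · refine ContinuousAt.rpow_const (by fun_prop) ?_
    refine h2.imp_left fun h => abs_ne_zero.2 (by contrapose! h; linarith)

theorem continuous_eval_ofReal (f : ℂ[X]) : Continuous fun t : ℝ => f.eval (t : ℂ) :=
  f.continuous.comp Complex.continuous_ofReal

theorem continuousAt_jacobiWeighted {α β t : ℝ} (f : ℂ[X]) (h1 : t ≠ 1 ∨ 0 ≤ α)
    (h2 : t ≠ -1 ∨ 0 ≤ β) : ContinuousAt (jacobiWeighted α β f) t :=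
  (continuous_eval_ofReal f).continuousAt.mul
    (Complex.continuous_ofReal.continuousAt.comp (continuousAt_jacobiAbsWeight h1 h2))

/-- The signs come from differentiating the absolute values; their product is constant on each
component of `ℝ \ {1, -1}`. -/
theorem hasDerivAt_jacobiWeighted (α β : ℝ) (f : ℂ[X]) {t : ℝ} (h1 : t ≠ 1) (h2 : t ≠ -1) :
    HasDerivAt (jacobiWeighted (α + 1) (β + 1) f)
      (((SignType.sign (1 - t) * SignType.sign (1 + t) : ℝ) : ℂ) *
        jacobiWeighted α β (jacobiRaise α β f) t) t := by
  have h1' : 1 - t ≠ 0 := sub_ne_zero.2 h1.symm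
  have h2' : 1 + t ≠ 0 := by contrapose! h2; linarith
  have d1 := ((hasDerivAt_abs h1').comp t ((hasDerivAt_id' t).const_sub 1)).rpow_const
    (p := α + 1) (Or.inl (abs_ne_zero.2 h1'))
  have d2 := ((hasDerivAt_abs h2').comp t ((hasDerivAt_id' t).const_add 1)).rpow_const
    (p := β + 1) (Or.inl (abs_ne_zero.2 h2'))
  have d3 : HasDerivAt (fun x : ℝ => f.eval (x : ℂ)) ((derivative f).eval (t : ℂ)) t :=
    (f.hasDerivAt (t : ℂ)).comp_ofReal
  have d := d3.mul (d1.mul d2).ofReal_comp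
  refine d.congr_deriv ?_
  have e1 : |1 - t| ^ (α + 1) = |1 - t| ^ α * |1 - t| := by
    rw [Real.rpow_add_one (abs_ne_zero.2 h1')]
  have e2 : |1 + t| ^ (β + 1) = |1 + t| ^ β * |1 + t| := by
    rw [Real.rpow_add_one (abs_ne_zero.2 h2')]
  have s1 : |1 - t| = SignType.sign (1 - t) * (1 - t) := (sign_mul_self _).symm
  have s2 : |1 + t| = SignType.sign (1 + t) * (1 + t) := (sign_mul_self _).symm
  simp only [add_sub_cancel_right, jacobiWeighted, jacobiAbsWeight, jacobiRaise, Pi.mul_apply,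
    Function.comp, e1, e2]
  generalize |1 - t| ^ α = u
  generalize |1 + t| ^ β = v
  rw [s1, s2]
  simp only [eval_add, eval_mul, eval_sub, eval_one, eval_pow, eval_X, eval_C]
  push_cast
  ring

theorem tendsto_eval_div_pow (f : ℂ[X]) {d : ℕ} (hd : f.natDegree ≤ d) :
    Tendsto (fun t : ℝ => f.eval (t : ℂ) / (t : ℂ) ^ d) atTop (𝓝 (f.coeff d)) := by
  have h1 : Tendsto (fun t : ℝ => ∑ i ∈ Finset.range (d + 1), f.coeff i * ((t : ℂ)⁻¹) ^ (d - i))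
      atTop (𝓝 (∑ i ∈ Finset.range (d + 1), f.coeff i * (0 : ℂ) ^ (d - i))) := by
    refine tendsto_finsetSum _ fun i _ => ((Tendsto.pow ?_ _).const_mul _)
    have := (Complex.continuous_ofReal.tendsto 0).comp tendsto_inv_atTop_zero
    simpa [Function.comp_def] using this
  have h2 : ∑ i ∈ Finset.range (d + 1), f.coeff i * (0 : ℂ) ^ (d - i) = f.coeff d := by
    rw [Finset.sum_range_succ, Finset.sum_eq_zero]
    · simp
    · intro i hi
      have : d - i ≠ 0 := by have := Finset.mem_range.1 hi; omega
      simp [this]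
  rw [h2] at h1
  refine h1.congr' ?_
  filter_upwards [eventually_gt_atTop 0] with t ht
  have ht' : (t : ℂ) ≠ 0 := by exact_mod_cast ht.ne'
  rw [eval_eq_sum_range' (Nat.lt_succ_of_le hd), Finset.sum_div]
  refine Finset.sum_congr rfl fun i hi => ?_
  have : d = i + (d - i) := by have := Finset.mem_range.1 hi; omega
  rw [mul_div_assoc]
  congr 1
  conv_rhs => rw [this, pow_add]
  rw [inv_pow]
  field_simp

theorem tendsto_jacobiAbsWeight_mul_rpow (α β : ℝ) :
    Tendsto (fun t => jacobiAbsWeight α β t * t ^ (-(α + β))) atTop (𝓝 1) := by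
  have h0 : Tendsto (fun t : ℝ => t⁻¹) atTop (𝓝 0) := tendsto_inv_atTop_zero
  have h1 : Tendsto (fun t : ℝ => (1 - t⁻¹) ^ α * (1 + t⁻¹) ^ β) atTop
      (𝓝 ((1 - 0) ^ α * (1 + 0) ^ β)) :=
    ((h0.const_sub 1).rpow_const (Or.inl (by norm_num))).mul
      ((h0.const_add 1).rpow_const (Or.inl (by norm_num)))
  simp only [sub_zero, add_zero, Real.one_rpow, mul_one] at h1
  refine h1.congr' ?_
  filter_upwards [eventually_gt_atTop 1] with t ht
  have ht0 : 0 < t := by linarith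
  have hi : t⁻¹ ≤ 1 := inv_le_one_of_one_le₀ ht.le
  have hi0 : 0 < t⁻¹ := inv_pos.2 ht0
  have e1 : |1 - t| = t * (1 - t⁻¹) := by
    rw [abs_of_neg (by linarith)]; field_simp; ring
  have e2 : |1 + t| = t * (1 + t⁻¹) := by
    rw [abs_of_pos (by linarith)]; field_simp; ring
  rw [jacobiAbsWeight, e1, e2, Real.mul_rpow ht0.le (by linarith),
    Real.mul_rpow ht0.le (by linarith), neg_add, Real.rpow_add ht0, Real.rpow_neg ht0.le,
    Real.rpow_neg ht0.le]
  have := (Real.rpow_pos_of_pos ht0 α).ne'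
  have := (Real.rpow_pos_of_pos ht0 β).ne'
  field_simp

/-- Here `d` only bounds the degree, so the limit may be zero; when it is not, the growth rate is
exact. -/
theorem tendsto_jacobiWeighted_mul_rpow (α β : ℝ) (f : ℂ[X]) {d : ℕ} (hd : f.natDegree ≤ d) :
    Tendsto (fun t : ℝ => jacobiWeighted α β f t * ((t ^ (-(d + α + β)) : ℝ) : ℂ)) atTop
      (𝓝 (f.coeff d)) := by
  have h := (tendsto_eval_div_pow f hd).mul
    ((Complex.continuous_ofReal.tendsto 1).comp (tendsto_jacobiAbsWeight_mul_rpow α β))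
  rw [Complex.ofReal_one, mul_one] at h
  refine h.congr' ?_
  filter_upwards [eventually_gt_atTop 0] with t ht
  have e : t ^ (-(d + α + β)) = (t ^ d)⁻¹ * t ^ (-(α + β)) := by
    rw [← Real.rpow_natCast, ← Real.rpow_neg ht.le, ← Real.rpow_add ht]
    congr 1; ring
  rw [e]
  simp only [Function.comp, jacobiWeighted]
  push_cast
  ring

theorem jacobiWeighted_isBigO (α β : ℝ) (f : ℂ[X]) {d : ℕ} (hd : f.natDegree ≤ d) :
    jacobiWeighted α β f =O[atTop] fun t : ℝ => t ^ (d + α + β) := by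
  have h := (tendsto_jacobiWeighted_mul_rpow α β f hd).isBigO_one ℝ
  have h2 := h.mul (Complex.isBigO_ofReal_left.2
    (Asymptotics.isBigO_refl (fun t : ℝ => t ^ (d + α + β)) atTop))
  refine (h2.congr' ?_ ?_)
  · filter_upwards [eventually_gt_atTop 0] with t ht
    rw [mul_assoc, ← Complex.ofReal_mul, ← Real.rpow_add ht, neg_add_cancel, Real.rpow_zero,
      Complex.ofReal_one, mul_one]
  · exact Eventually.of_forall fun t => one_mul _

theorem rpow_isBigO_jacobiWeighted (α β : ℝ) (f : ℂ[X]) {d : ℕ} (hd : f.natDegree ≤ d)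
    (h0 : f.coeff d ≠ 0) :
    (fun t : ℝ => t ^ (d + α + β)) =O[atTop] jacobiWeighted α β f := by
  have h := ((tendsto_jacobiWeighted_mul_rpow α β f hd).inv₀ h0).isBigO_one ℂ
  have h2 := h.mul (Asymptotics.isBigO_refl (jacobiWeighted α β f) atTop)
  have h3 := (tendsto_jacobiWeighted_mul_rpow α β f hd).eventually_ne h0
  refine Complex.isBigO_ofReal_left.1 (h2.congr' ?_ (Eventually.of_forall fun t => one_mul _))
  filter_upwards [eventually_gt_atTop 0, h3] with t ht h4
  rw [Real.rpow_neg ht.le, Complex.ofReal_inv, mul_inv, inv_inv, mul_right_comm,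
    inv_mul_cancel₀ (left_ne_zero_of_mul h4), one_mul]

theorem tendsto_jacobiWeighted_zero {α β : ℝ} (f : ℂ[X]) (hd : f.natDegree + α + β < 0) :
    Tendsto (jacobiWeighted α β f) atTop (𝓝 0) := by
  refine (jacobiWeighted_isBigO α β f le_rfl).trans_tendsto ?_
  have := tendsto_rpow_neg_atTop (y := -(f.natDegree + α + β)) (by linarith)
  simpa using this

/-! ### Integrability of weighted polynomials -/

theorem intervalIntegrable_abs_rpow {r : ℝ} (h : -1 < r) (a b : ℝ) :
    IntervalIntegrable (fun x : ℝ => |x| ^ r) volume a b := by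
  have h0 : ∀ c : ℝ, 0 ≤ c → IntervalIntegrable (fun x : ℝ => |x| ^ r) volume 0 c := by
    intro c hc
    refine (intervalIntegral.intervalIntegrable_rpow' h).congr fun x hx => ?_
    rw [Set.uIoc_of_le hc] at hx
    simp only [abs_of_pos hx.1]
  have h1 : ∀ c : ℝ, IntervalIntegrable (fun x : ℝ => |x| ^ r) volume 0 c := by
    intro c
    rcases le_total 0 c with hc | hc
    · exact h0 c hc
    · simpa using (h0 (-c) (by linarith)).comp_sub_left 0
  exact (h1 a).symm.trans (h1 b)

/-- Away from `-1` the only possible singularity is at `1`, integrable since `α > -1`. The interval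
may lie on either side of `1`, which serves both bounded and unbounded `Δ`. -/
theorem integrableOn_jacobiWeighted_Icc {α : ℝ} (β : ℝ) (hα : -1 < α) (f : ℂ[X]) {a b : ℝ}
    (ha : -1 < a) (hab : a ≤ b) : IntegrableOn (jacobiWeighted α β f) (Set.Icc a b) := by
  rw [← intervalIntegrable_iff_integrableOn_Icc_of_le hab]
  have h1 : IntervalIntegrable (fun t : ℝ => |1 - t| ^ α) volume a b := by
    simpa using (intervalIntegrable_abs_rpow hα (1 - a) (1 - b)).comp_sub_left 1
  have h2 : IntervalIntegrable (fun t : ℝ => ((|1 - t| ^ α : ℝ) : ℂ)) volume a b :=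
    ⟨h1.1.ofReal, h1.2.ofReal⟩
  have h3 : ContinuousOn (fun t : ℝ => f.eval (t : ℂ) * ((|1 + t| ^ β : ℝ) : ℂ))
      (Set.uIcc a b) := by
    refine (continuous_eval_ofReal f).continuousOn.mul
      (Complex.continuous_ofReal.comp_continuousOn ?_)
    refine ContinuousOn.rpow_const (by fun_prop) fun t ht => Or.inl ?_
    rw [Set.uIcc_of_le hab] at ht
    exact abs_ne_zero.2 (by have := ht.1; intro h; linarith)
  refine (h2.mul_continuousOn h3).congr fun t _ => ?_
  simp only [jacobiWeighted, jacobiAbsWeight]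
  push_cast
  ring

/-- The reflection `t ↦ -t` exchanges `α` and `β`, so the endpoint `-1` and the left half-line need
no separate analysis. -/
theorem integrableOn_jacobiWeighted_neg {α β : ℝ} {f : ℂ[X]} {s : Set ℝ} :
    IntegrableOn (jacobiWeighted β α (f.comp (-X))) (-s) ↔
      IntegrableOn (jacobiWeighted α β f) s := by
  rw [← (Measure.measurePreserving_neg (volume : Measure ℝ)).integrableOn_comp_preimage
    (MeasurableEquiv.neg ℝ).measurableEmbedding (f := jacobiWeighted α β f) (s := s)]
  have : jacobiWeighted α β f ∘ Neg.neg = jacobiWeighted β α (f.comp (-X)) :=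
    funext fun t => jacobiWeighted_neg α β f t
  rw [this]
  rfl

theorem integrableOn_jacobiWeighted_Icc_neg_one_one {α β : ℝ} (hα : -1 < α) (hβ : -1 < β)
    (f : ℂ[X]) : IntegrableOn (jacobiWeighted α β f) (Set.Icc (-1) 1) := by
  have h1 : IntegrableOn (jacobiWeighted α β f) (Set.Icc 0 1) :=
    integrableOn_jacobiWeighted_Icc β hα f (by norm_num) zero_le_one
  have h2 : IntegrableOn (jacobiWeighted α β f) (Set.Icc (-1) 0) := by
    rw [← integrableOn_jacobiWeighted_neg, Set.neg_Icc, neg_zero, neg_neg]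
    exact integrableOn_jacobiWeighted_Icc α hβ _ (by norm_num) zero_le_one
  rw [← Set.Icc_union_Icc_eq_Icc (b := (0 : ℝ)) (by norm_num) zero_le_one]
  exact h2.union h1

theorem integrableOn_jacobiWeighted_Ici {α β : ℝ} (hα : -1 < α) (f : ℂ[X])
    (hf : f.natDegree + α + β < -1) : IntegrableOn (jacobiWeighted α β f) (Set.Ici 1) := by
  refine LocallyIntegrableOn.integrableOn_of_isBigO_atTop (fun x hx => ?_)
    (jacobiWeighted_isBigO α β f le_rfl) (integrableAtFilter_rpow_atTop_iff.2 hf)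
  refine ⟨Set.Icc 1 (x + 1), ?_, integrableOn_jacobiWeighted_Icc β hα f (by norm_num) ?_⟩
  · rw [← Set.Ici_inter_Iic]
    exact inter_mem self_mem_nhdsWithin (mem_nhdsWithin_of_mem_nhds (Iic_mem_nhds (by linarith)))
  · have : (1 : ℝ) ≤ x := hx
    linarith

theorem integrableOn_jacobiWeighted_Iic {α β : ℝ} (hβ : -1 < β) (f : ℂ[X])
    (hf : f.natDegree + α + β < -1) : IntegrableOn (jacobiWeighted α β f) (Set.Iic (-1)) := by
  rw [← integrableOn_jacobiWeighted_neg, Set.neg_Iic, neg_neg]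
  refine integrableOn_jacobiWeighted_Ici hβ _ ?_
  rw [natDegree_comp_neg_X]
  linarith

theorem not_integrableOn_jacobiWeighted_Ici {α β : ℝ} {f : ℂ[X]}
    (h0 : f ≠ 0) (hf : -1 ≤ f.natDegree + α + β) :
    ¬ IntegrableOn (jacobiWeighted α β f) (Set.Ici 1) := by
  intro h
  have h1 := (rpow_isBigO_jacobiWeighted α β f le_rfl (by simpa using h0)).integrableAtFilter
    (μ := volume) ?_ ⟨Set.Ici 1, Ici_mem_atTop 1, h⟩
  · exact absurd (integrableAtFilter_rpow_atTop_iff.1 h1) (not_lt.2 hf)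
  · exact (Measurable.stronglyMeasurable (by fun_prop)).stronglyMeasurableAtFilter

theorem not_integrableOn_jacobiWeighted_Iic {α β : ℝ} {f : ℂ[X]}
    (h0 : f ≠ 0) (hf : -1 ≤ f.natDegree + α + β) :
    ¬ IntegrableOn (jacobiWeighted α β f) (Set.Iic (-1)) := by
  rw [← integrableOn_jacobiWeighted_neg, Set.neg_Iic, neg_neg]
  refine not_integrableOn_jacobiWeighted_Ici ?_ ?_
  · intro h
    apply h0
    have := congrArg (fun g : ℂ[X] => g.comp (-X)) h
    simpa [comp_assoc] using this
  · rw [natDegree_comp_neg_X]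
    linarith

/-! ### Integrals of derivatives -/

theorem integral_jacobiRaise_Icc {α β : ℝ} (hα : -1 < α) (hβ : -1 < β) (f : ℂ[X]) :
    ∫ t in Set.Icc (-1) 1, jacobiWeighted α β (jacobiRaise α β f) t = 0 := by
  have hint := integrableOn_jacobiWeighted_Icc_neg_one_one hα hβ (jacobiRaise α β f)
  rw [← intervalIntegrable_iff_integrableOn_Icc_of_le (by norm_num)] at hint
  have h := intervalIntegral.integral_eq_sub_of_hasDerivAt_of_le (a := -1) (b := 1)
    (f := jacobiWeighted (α + 1) (β + 1) f) (by norm_num)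
    (fun t _ => (continuousAt_jacobiWeighted f (Or.inr (by linarith))
      (Or.inr (by linarith))).continuousWithinAt) (fun t ht => ?_) hint
  · rw [intervalIntegral.integral_of_le (by norm_num), ← integral_Icc_eq_integral_Ioc] at h
    rw [h]
    simp [jacobiWeighted, jacobiAbsWeight, Real.zero_rpow (show α + 1 ≠ 0 by linarith),
      Real.zero_rpow (show β + 1 ≠ 0 by linarith)]
  · have h := hasDerivAt_jacobiWeighted α β f ht.2.ne ht.1.ne'
    rwa [sign_pos (sub_pos.2 ht.2), sign_pos (by linarith [ht.1]), SignType.coe_one, mul_one,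
      Complex.ofReal_one, one_mul] at h

/-- The primitive vanishes at `1` because `α + 1 > 0`, and at infinity because its growth exponent
is at most `deg f + α + β + 2 < 0`. -/
theorem integral_jacobiRaise_Ici {α β : ℝ} (hα : -1 < α) (f : ℂ[X])
    (hf : f.natDegree + α + β + 2 < 0) :
    ∫ t in Set.Ici 1, jacobiWeighted α β (jacobiRaise α β f) t = 0 := by
  have hd : ((jacobiRaise α β f).natDegree : ℝ) ≤ f.natDegree + 1 := by
    exact_mod_cast natDegree_jacobiRaise_le α β f
  have hint := integrableOn_jacobiWeighted_Ici (β := β) hα (jacobiRaise α β f) (by linarith)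
  rw [integrableOn_Ici_iff_integrableOn_Ioi] at hint
  -- To the right of `1` the product of signs is `-1`, hence `hint.neg`.
  have h := integral_Ioi_of_hasDerivAt_of_tendsto (a := 1)
    (f := jacobiWeighted (α + 1) (β + 1) f)
    (continuousAt_jacobiWeighted f (Or.inr (by linarith))
      (Or.inl (by norm_num))).continuousWithinAt (fun t ht => ?_) hint.neg
    (tendsto_jacobiWeighted_zero f (by linarith))
  · rw [integral_Ici_eq_integral_Ioi]
    simp only [Pi.neg_apply] at h
    rw [integral_neg, neg_eq_iff_eq_neg] at h
    rw [h]
    simp [jacobiWeighted, jacobiAbsWeight, Real.zero_rpow (show α + 1 ≠ 0 by linarith)]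
  · have ht : (1 : ℝ) < t := ht
    have h := hasDerivAt_jacobiWeighted α β f ht.ne' (by linarith)
    rw [sign_neg (sub_neg.2 ht), sign_pos (by linarith)] at h
    simpa using h

theorem integral_jacobiRaise_Iic {α β : ℝ} (hβ : -1 < β) (f : ℂ[X])
    (hf : f.natDegree + α + β + 2 < 0) :
    ∫ t in Set.Iic (-1), jacobiWeighted α β (jacobiRaise α β f) t = 0 := by
  rw [← integral_comp_neg_Ioi, ← integral_Ici_eq_integral_Ioi]
  have h := integral_jacobiRaise_Ici (α := β) (β := α) hβ (f.comp (-X))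
    (by rw [natDegree_comp_neg_X]; linarith)
  simp only [jacobiWeighted_neg, jacobiRaise_comp_neg_X]
  simpa [jacobiWeighted, integral_neg] using h

/-! ### Orthogonality with respect to the positive weight -/

theorem Iic_ne_Icc : Set.Iic (-1 : ℝ) ≠ Set.Icc (-1) 1 := by
  intro h
  have : (-2 : ℝ) ∈ Set.Icc (-1 : ℝ) 1 := h ▸ (by norm_num : (-2 : ℝ) ≤ -1)
  norm_num at this

theorem Ici_ne_Icc : Set.Ici (1 : ℝ) ≠ Set.Icc (-1) 1 := by
  intro h
  have : (2 : ℝ) ∈ Set.Icc (-1 : ℝ) 1 := h ▸ (by norm_num : (1 : ℝ) ≤ 2)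
  norm_num at this

section OrthogonalitySets

variable {n : ℕ} {α β : ℝ} {Δ : Set ℝ}

/-- The induction is possible because `2n + α + β` is invariant under lowering `n` by one and
raising both parameters by one. -/
theorem IsOrthogonalitySet.raise (hΔ : IsOrthogonalitySet (n + 1) α β Δ) :
    IsOrthogonalitySet n (α + 1) (β + 1) Δ := by
  unfold IsOrthogonalitySet at *
  push_cast at hΔ
  rcases hΔ with ⟨h1, h2, h3⟩ | ⟨h1, h2, h3⟩ | ⟨h1, h2, h3⟩
  · exact Or.inl ⟨by linarith, by linarith, h3⟩
  · exact Or.inr (Or.inl ⟨by linarith, by linarith, h3⟩)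
  · exact Or.inr (Or.inr ⟨by linarith, by linarith, h3⟩)

theorem IsOrthogonalitySet.measurableSet (hΔ : IsOrthogonalitySet n α β Δ) :
    MeasurableSet Δ := by
  rcases hΔ with ⟨_, _, rfl⟩ | ⟨_, _, rfl⟩ | ⟨_, _, rfl⟩
  exacts [measurableSet_Icc, measurableSet_Iic, measurableSet_Ici]

theorem IsOrthogonalitySet.integrableOn (hΔ : IsOrthogonalitySet n α β Δ) (f : ℂ[X])
    (hf : Δ = Set.Icc (-1) 1 ∨ f.natDegree + α + β < -1) :
    IntegrableOn (jacobiWeighted α β f) Δ := by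
  rcases hΔ with ⟨h1, h2, rfl⟩ | ⟨h1, h2, rfl⟩ | ⟨h1, h2, rfl⟩
  · exact integrableOn_jacobiWeighted_Icc_neg_one_one h1 h2 f
  · exact integrableOn_jacobiWeighted_Iic h2 f (hf.resolve_left Iic_ne_Icc)
  · exact integrableOn_jacobiWeighted_Ici h2 f (hf.resolve_left Ici_ne_Icc)

/-- On a half-line, degree at most `2n - 1` gives growth exponent at most `2n + α + β - 1 < -1`. -/
theorem IsOrthogonalitySet.integrableOn_of_natDegree_lt (hΔ : IsOrthogonalitySet n α β Δ)
    (f : ℂ[X]) (hf : f.natDegree + 1 ≤ 2 * n) : IntegrableOn (jacobiWeighted α β f) Δ := by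
  refine hΔ.integrableOn f ?_
  have hf' : (f.natDegree : ℝ) + 1 ≤ 2 * n := by exact_mod_cast hf
  rcases hΔ with ⟨_, _, h⟩ | ⟨h, _⟩ | ⟨h, _⟩
  exacts [Or.inl h, Or.inr (by linarith), Or.inr (by linarith)]

theorem IsOrthogonalitySet.integral_jacobiRaise (hΔ : IsOrthogonalitySet (n + 1) α β Δ)
    (f : ℂ[X]) (hf : f.natDegree ≤ 2 * n) :
    ∫ t in Δ, jacobiWeighted α β (jacobiRaise α β f) t = 0 := by
  have hf' : (f.natDegree : ℝ) ≤ 2 * n := by exact_mod_cast hf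
  unfold IsOrthogonalitySet at hΔ
  push_cast at hΔ
  rcases hΔ with ⟨h1, h2, rfl⟩ | ⟨h1, h2, rfl⟩ | ⟨h1, h2, rfl⟩
  · exact integral_jacobiRaise_Icc h1 h2 f
  · exact integral_jacobiRaise_Iic h2 f (by linarith)
  · exact integral_jacobiRaise_Ici h2 f (by linarith)

theorem jacobiWeighted_one_sub_sq_mul (α β : ℝ) (f : ℂ[X]) {t : ℝ} (h1 : t ≠ 1) (h2 : t ≠ -1) :
    jacobiWeighted α β ((1 - X ^ 2) * f) t =
      ((SignType.sign (1 - t) * SignType.sign (1 + t) : ℝ) : ℂ) *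
        jacobiWeighted (α + 1) (β + 1) f t := by
  have h1' : 1 - t ≠ 0 := sub_ne_zero.2 h1.symm
  have h2' : 1 + t ≠ 0 := by contrapose! h2; linarith
  simp only [jacobiWeighted, jacobiAbsWeight, Real.rpow_add_one (abs_ne_zero.2 h1'),
    Real.rpow_add_one (abs_ne_zero.2 h2'), eval_mul, eval_sub, eval_one, eval_pow, eval_X]
  have s1 := congrArg (fun x : ℝ => (x : ℂ)) (sign_mul_abs (1 - t))
  have s2 := congrArg (fun x : ℝ => (x : ℂ)) (sign_mul_abs (1 + t))
  have e : (1 - (t : ℂ) ^ 2) = ((1 - t : ℝ) : ℂ) * ((1 + t : ℝ) : ℂ) := by push_cast; ring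
  rw [e]
  rw [← s1, ← s2]
  push_cast
  ring

theorem ae_ne_one_and_ne_neg_one : ∀ᵐ t : ℝ, t ≠ 1 ∧ t ≠ -1 :=
  (Measure.ae_ne volume 1).and (Measure.ae_ne volume (-1))

theorem IsOrthogonalitySet.exists_sign_eq (hΔ : IsOrthogonalitySet n α β Δ) :
    ∃ s : ℝ, ∀ t ∈ Δ, t ≠ 1 → t ≠ -1 →
      (SignType.sign (1 - t) * SignType.sign (1 + t) : ℝ) = s := by
  rcases hΔ with ⟨_, _, rfl⟩ | ⟨_, _, rfl⟩ | ⟨_, _, rfl⟩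
  · refine ⟨1, fun t ht h1 h2 => ?_⟩
    have := lt_of_le_of_ne ht.2 h1
    have := lt_of_le_of_ne ht.1 h2.symm
    rw [sign_pos (by linarith), sign_pos (by linarith)]; simp
  · refine ⟨-1, fun t ht h1 h2 => ?_⟩
    have := lt_of_le_of_ne (Set.mem_Iic.1 ht) h2
    rw [sign_pos (by linarith), sign_neg (by linarith)]; simp
  · refine ⟨-1, fun t ht h1 h2 => ?_⟩
    have := lt_of_le_of_ne (Set.mem_Ici.1 ht) h1.symm
    rw [sign_neg (by linarith), sign_pos (by linarith)]; simp

theorem IsOrthogonalitySet.integral_one_sub_sq_mul (hΔ : IsOrthogonalitySet n α β Δ)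
    {f : ℂ[X]} (hf : ∫ t in Δ, jacobiWeighted (α + 1) (β + 1) f t = 0) :
    ∫ t in Δ, jacobiWeighted α β ((1 - X ^ 2) * f) t = 0 := by
  obtain ⟨s, hs⟩ := hΔ.exists_sign_eq
  have h : ∫ t in Δ, jacobiWeighted α β ((1 - X ^ 2) * f) t =
      ∫ t in Δ, (s : ℂ) * jacobiWeighted (α + 1) (β + 1) f t := by
    refine setIntegral_congr_ae hΔ.measurableSet ?_
    filter_upwards [ae_ne_one_and_ne_neg_one] with t ht htΔ
    rw [jacobiWeighted_one_sub_sq_mul α β f ht.1 ht.2, hs t htΔ ht.1 ht.2]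
  rw [h, integral_const_mul, hf, mul_zero]

theorem IsOrthogonalitySet.integral_mul_jacobiP (hΔ : IsOrthogonalitySet n α β Δ) {q : ℂ[X]}
    (hq : q.degree < n) : ∫ t in Δ, jacobiWeighted α β (q * jacobiP n α β) t = 0 := by
  induction n generalizing α β q with
  | zero =>
    have : q = 0 := by simpa [Nat.WithBot.lt_zero_iff] using hq
    simp [this, jacobiWeighted]
  | succ n ih =>
    set P := jacobiP n (α + 1 : ℂ) (β + 1) with hP
    have hPd : P.natDegree ≤ n := natDegree_jacobiP_le _ _ _
    have hqd : q.natDegree ≤ n :=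
      natDegree_le_iff_coeff_eq_zero.2 ((degree_lt_iff_coeff_zero _ _).1 hq)
    have hq' : (derivative q).degree < n := by
      rcases eq_or_ne q 0 with rfl | h0
      · simp
      · exact (degree_derivative_lt h0).trans_le (natDegree_le_iff_degree_le.1 hqd)
    have hI := ih hΔ.raise hq'
    push_cast at hI
    rw [← hP] at hI
    have h1 := hΔ.integral_one_sub_sq_mul hI
    have h2 := hΔ.integral_jacobiRaise (q * P)
      ((natDegree_mul_le_of_le hqd hPd).trans (by omega))
    have d1 : (q * jacobiRaise α β P).natDegree ≤ 2 * n + 1 :=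
      (natDegree_mul_le_of_le hqd (natDegree_jacobiRaise_le _ _ _)).trans (by omega)
    have d2 : (jacobiRaise α β (q * P)).natDegree ≤ 2 * n + 1 :=
      (natDegree_jacobiRaise_le _ _ _).trans
        (by have := natDegree_mul_le_of_le hqd hPd; omega)
    -- Integration by parts: the left side integrates to zero by induction and the first term on the
    -- right by the boundary values, hence so does the last.
    have e : (1 - X ^ 2) * (derivative q * P) =
        jacobiRaise α β (q * P) - q * jacobiRaise α β P := by
      rw [jacobiRaise_mul]; ring
    have hs : ∀ t, jacobiWeighted α β ((1 - X ^ 2) * (derivative q * P)) t =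
        jacobiWeighted α β (jacobiRaise α β (q * P)) t -
          jacobiWeighted α β (q * jacobiRaise α β P) t := by
      intro t
      rw [e, jacobiWeighted, eval_sub, sub_mul]; rfl
    simp only [hs] at h1
    rw [integral_sub (hΔ.integrableOn_of_natDegree_lt _ (by omega))
      (hΔ.integrableOn_of_natDegree_lt _ (by omega)), h2, zero_sub, neg_eq_zero] at h1
    rw [hP, jacobiRaise_jacobiP] at h1
    have hm : ∀ t, jacobiWeighted α β (q * (C (-2 * (n + 1 : ℂ)) * jacobiP (n + 1) α β)) t =
        (-2 * (n + 1 : ℂ)) * jacobiWeighted α β (q * jacobiP (n + 1) α β) t := by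
      intro t
      simp only [jacobiWeighted, eval_mul, eval_C]; ring
    simp only [hm, integral_const_mul] at h1
    have hn : (n + 1 : ℂ) ≠ 0 := by exact_mod_cast n.succ_ne_zero
    exact (mul_eq_zero.1 h1).resolve_left (mul_ne_zero (by norm_num) hn)

/-! ### Branches of the Jacobi weight -/

theorem exists_eq_log_abs_add_of_exp_eq {x : ℝ} (hx : x ≠ 0) {a : ℂ} (ha : Complex.exp a = x) :
    ∃ j : ℤ, a = (Real.log |x| : ℝ) + j * (Real.pi * Complex.I) := by
  have h0 : Complex.exp ((Real.log |x| : ℝ) : ℂ) = ((|x| : ℝ) : ℂ) := by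
    rw [← Complex.ofReal_exp, Real.exp_log (abs_pos.2 hx)]
  rcases lt_or_gt_of_ne hx with h | h
  · have h1 : Complex.exp a =
        Complex.exp (((Real.log |x| : ℝ) : ℂ) + Real.pi * Complex.I) := by
      rw [Complex.exp_add, h0, Complex.exp_pi_mul_I, ha, abs_of_neg h]; simp
    obtain ⟨m, hm⟩ := Complex.exp_eq_exp_iff_exists_int.1 h1
    refine ⟨2 * m + 1, ?_⟩
    rw [hm]; push_cast; ring
  · have h1 : Complex.exp a = Complex.exp ((Real.log |x| : ℝ) : ℂ) := by
      rw [h0, ha, abs_of_pos h]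
    obtain ⟨m, hm⟩ := Complex.exp_eq_exp_iff_exists_int.1 h1
    refine ⟨2 * m, ?_⟩
    rw [hm]; push_cast; ring

/-- On a connected set avoiding `±1`, a continuous branch of the Jacobi weight is a constant
multiple of the positive weight. -/
theorem IsJacobiWeightBranch.exists_eq_const_mul {w : ℝ → ℂ} (hw : IsJacobiWeightBranch α β Δ w)
    (hc : IsPreconnected (interior Δ)) (h1 : (1 : ℝ) ∉ interior Δ) (h2 : (-1 : ℝ) ∉ interior Δ) :
    ∃ c : ℂ, c ≠ 0 ∧ ∀ t ∈ interior Δ, w t = c * (jacobiAbsWeight α β t : ℂ) := by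
  have hne1 : ∀ t ∈ interior Δ, t ≠ 1 := fun t ht h => h1 (h ▸ ht)
  have hne2 : ∀ t ∈ interior Δ, t ≠ -1 := fun t ht h => h2 (h ▸ ht)
  have hpos : ∀ t ∈ interior Δ, (jacobiAbsWeight α β t : ℂ) ≠ 0 := fun t ht => by
    exact_mod_cast (jacobiAbsWeight_pos α β (hne1 t ht) (hne2 t ht)).ne'
  set g : ℝ → ℂ := fun t => w t / (jacobiAbsWeight α β t : ℂ) with hg
  set E : ℤ × ℤ → ℂ := fun m =>
    Complex.exp ((α : ℂ) * (m.1 * (Real.pi * Complex.I)) + β * (m.2 * (Real.pi * Complex.I)))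
    with hE
  have hcont : ContinuousOn g (interior Δ) := by
    refine hw.1.div (fun t ht => ?_) hpos
    exact (Complex.continuous_ofReal.continuousAt.comp (continuousAt_jacobiAbsWeight
      (Or.inl (hne1 t ht)) (Or.inl (hne2 t ht)))).continuousWithinAt
  have hmem : ∀ t ∈ interior Δ, g t ∈ Set.range E := by
    intro t ht
    obtain ⟨a, b, ha, hb, hab⟩ := hw.2 t ht
    have h1' : 1 - t ≠ 0 := sub_ne_zero.2 (hne1 t ht).symm
    have h2' : 1 + t ≠ 0 := by have := hne2 t ht; contrapose! this; linarith
    obtain ⟨j, hj⟩ := exists_eq_log_abs_add_of_exp_eq h1' (a := a) (by rw [ha]; push_cast; rfl)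
    obtain ⟨k, hk⟩ := exists_eq_log_abs_add_of_exp_eq h2' (a := b) (by rw [hb]; push_cast; rfl)
    refine ⟨(j, k), ?_⟩
    have e : (jacobiAbsWeight α β t : ℂ) =
        Complex.exp (α * (Real.log |1 - t| : ℝ) + β * (Real.log |1 + t| : ℝ)) := by
      rw [jacobiAbsWeight, Real.rpow_def_of_pos (abs_pos.2 h1'),
        Real.rpow_def_of_pos (abs_pos.2 h2'), ← Real.exp_add, Complex.ofReal_exp]
      push_cast
      ring_nf
    rw [hg, hE]
    simp only
    rw [eq_div_iff (hpos t ht), e, ← Complex.exp_add, hab, hj, hk]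
    ring_nf
  -- The quotient takes values in a countable set, which is totally disconnected, so on a connected
  -- set it is constant.
  have hsub : (g '' interior Δ).Subsingleton :=
    (Set.countable_range E).isTotallyDisconnected _
      (Set.image_subset_iff.2 hmem) (hc.image g hcont)
  rcases (interior Δ).eq_empty_or_nonempty with h | ⟨s, hs⟩
  · exact ⟨1, one_ne_zero, by simp [h]⟩
  · refine ⟨g s, ?_, fun t ht => ?_⟩
    · obtain ⟨m, hm⟩ := hmem s hs
      rw [← hm]
      exact Complex.exp_ne_zero _
    · rw [hsub (Set.mem_image_of_mem g hs) (Set.mem_image_of_mem g ht)]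
      exact (div_mul_cancel₀ _ (hpos t ht)).symm

theorem IsOrthogonalitySet.mem_interior (hΔ : IsOrthogonalitySet n α β Δ) {t : ℝ} (ht : t ∈ Δ)
    (h1 : t ≠ 1) (h2 : t ≠ -1) : t ∈ interior Δ := by
  rcases hΔ with ⟨_, _, rfl⟩ | ⟨_, _, rfl⟩ | ⟨_, _, rfl⟩
  · rw [interior_Icc]; exact ⟨lt_of_le_of_ne ht.1 h2.symm, lt_of_le_of_ne ht.2 h1⟩
  · rw [interior_Iic]; exact lt_of_le_of_ne ht h2
  · rw [interior_Ici]; exact lt_of_le_of_ne ht h1.symm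

theorem IsOrthogonalitySet.interior_nonempty (hΔ : IsOrthogonalitySet n α β Δ) :
    (interior Δ).Nonempty := by
  rcases hΔ with ⟨_, _, rfl⟩ | ⟨_, _, rfl⟩ | ⟨_, _, rfl⟩
  · rw [interior_Icc]; exact ⟨0, by norm_num⟩
  · rw [interior_Iic]; exact ⟨-2, by norm_num⟩
  · rw [interior_Ici]; exact ⟨2, by norm_num⟩

/-- Nothing is known about `w` at the endpoints, but these form a null set. -/
theorem IsOrthogonalitySet.exists_ae_eq (hΔ : IsOrthogonalitySet n α β Δ) {w : ℝ → ℂ}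
    (hw : IsJacobiWeightBranch α β Δ w) :
    ∃ c : ℂ, c ≠ 0 ∧ ∀ q p : ℂ[X], orthIntegrand w q p =ᵐ[volume.restrict Δ]
      fun t => c * jacobiWeighted α β (q * p) t := by
  have hc : IsPreconnected (interior Δ) ∧ (1 : ℝ) ∉ interior Δ ∧ (-1 : ℝ) ∉ interior Δ := by
    rcases hΔ with ⟨_, _, rfl⟩ | ⟨_, _, rfl⟩ | ⟨_, _, rfl⟩
    · rw [interior_Icc]; exact ⟨isPreconnected_Ioo, by simp, by simp⟩
    · rw [interior_Iic]; exact ⟨isPreconnected_Iio, by norm_num, by simp⟩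
    · rw [interior_Ici]; exact ⟨isPreconnected_Ioi, by simp, by norm_num⟩
  obtain ⟨c, hc0, h⟩ := hw.exists_eq_const_mul hc.1 hc.2.1 hc.2.2
  refine ⟨c, hc0, fun q p => (ae_restrict_iff' hΔ.measurableSet).2 ?_⟩
  filter_upwards [ae_ne_one_and_ne_neg_one] with t ht htΔ
  rw [orthIntegrand, h t (hΔ.mem_interior htΔ ht.1 ht.2), jacobiWeighted, eval_mul]
  ring

/-! ### Positivity and divergence -/

/-- The polynomial with conjugated coefficients. -/
noncomputable def conjPoly (f : ℂ[X]) : ℂ[X] := f.map (starRingEnd ℂ)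

theorem degree_conjPoly (f : ℂ[X]) : (conjPoly f).degree = f.degree :=
  degree_map f _

theorem natDegree_conjPoly (f : ℂ[X]) : (conjPoly f).natDegree = f.natDegree :=
  natDegree_map _

theorem jacobiWeighted_conjPoly_mul (α β : ℝ) (f : ℂ[X]) (t : ℝ) :
    jacobiWeighted α β (conjPoly f * f) t =
      ((‖f.eval (t : ℂ)‖ ^ 2 * jacobiAbsWeight α β t : ℝ) : ℂ) := by
  rw [jacobiWeighted, eval_mul, conjPoly, eval_map_conj_ofReal, Complex.conj_mul']
  push_cast
  ring

/-- The integrand is `|f|²` times the positive weight; inside `Δ` it vanishes at most at the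
finitely many roots of `f`. -/
theorem IsOrthogonalitySet.integral_conjPoly_mul_ne_zero (hΔ : IsOrthogonalitySet n α β Δ)
    {f : ℂ[X]} (hf : f ≠ 0) (hint : IntegrableOn (jacobiWeighted α β (conjPoly f * f)) Δ) :
    ∫ t in Δ, jacobiWeighted α β (conjPoly f * f) t ≠ 0 := by
  have hint' : IntegrableOn (fun t : ℝ => ‖f.eval (t : ℂ)‖ ^ 2 * jacobiAbsWeight α β t) Δ := by
    have := hint.re
    simp only [jacobiWeighted_conjPoly_mul, RCLike.re_to_complex, Complex.ofReal_re] at this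
    exact this
  simp only [jacobiWeighted_conjPoly_mul]
  rw [integral_complex_ofReal]
  refine Complex.ofReal_ne_zero.2 (ne_of_gt ?_)
  rw [setIntegral_pos_iff_support_of_nonneg_ae (Eventually.of_forall fun t =>
    mul_nonneg (sq_nonneg _) (jacobiAbsWeight_nonneg α β t)) hint']
  set F : Set ℝ := ((fun t : ℝ => (t : ℂ)) ⁻¹' {z | f.IsRoot z}) ∪ {1, -1} with hF
  have hFfin : F.Finite :=
    ((finite_setOfPred_isRoot hf).preimage Complex.ofReal_injective.injOn).union (by simp)
  have hpos : 0 < volume (interior Δ \ F) := by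
    rw [measure_sdiff_null (hFfin.measure_zero _)]
    exact isOpen_interior.measure_pos _ hΔ.interior_nonempty
  refine hpos.trans_le (measure_mono fun t ht => ⟨?_, interior_subset ht.1⟩)
  have h := ht.2
  simp only [hF, Set.mem_union, Set.mem_preimage, Set.mem_ofPred_eq, Set.mem_insert_iff,
    Set.mem_singleton_iff, not_or] at h
  refine mul_ne_zero (pow_ne_zero _ (norm_ne_zero_iff.2 h.1)) ?_
  exact (jacobiAbsWeight_pos α β h.2.1 h.2.2).ne'

theorem IsOrthogonalitySet.integrableOn_inter_Icc (hΔ : IsOrthogonalitySet n α β Δ) (f : ℂ[X])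
    (R : ℝ) : IntegrableOn (jacobiWeighted α β f) (Δ ∩ Set.Icc (-R) R) := by
  rcases hΔ with ⟨h1, h2, rfl⟩ | ⟨h1, h2, rfl⟩ | ⟨h1, h2, rfl⟩
  · exact (integrableOn_jacobiWeighted_Icc_neg_one_one h1 h2 f).mono_set Set.inter_subset_left
  · rw [← integrableOn_jacobiWeighted_neg]
    -- The maximum with `1` keeps the interval nonempty for small `R`.
    refine (integrableOn_jacobiWeighted_Icc α h2 _ (a := 1) (by norm_num)
      (le_max_left 1 R)).mono_set fun t ht => ?_
    have h3 : -t ≤ -1 := ht.1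
    have h4 : -R ≤ -t := ht.2.1
    exact ⟨by linarith, le_max_of_le_right (by linarith)⟩
  · exact (integrableOn_jacobiWeighted_Icc β h2 f (a := 1) (by norm_num)
      (le_max_left 1 R)).mono_set fun t ht => ⟨ht.1, le_max_of_le_right ht.2.2⟩

theorem IsOrthogonalitySet.not_integrableOn (hΔ : IsOrthogonalitySet n α β Δ)
    (hne : Δ ≠ Set.Icc (-1) 1) {f : ℂ[X]} (h0 : f ≠ 0) (hf : -1 ≤ f.natDegree + α + β) :
    ¬ IntegrableOn (jacobiWeighted α β f) Δ := by
  rcases hΔ with ⟨_, _, rfl⟩ | ⟨_, _, rfl⟩ | ⟨_, _, rfl⟩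
  · exact absurd rfl hne
  · exact not_integrableOn_jacobiWeighted_Iic h0 hf
  · exact not_integrableOn_jacobiWeighted_Ici h0 hf

theorem tendsto_integral_inter_Icc {f : ℝ → ℂ} (hf : IntegrableOn f Δ) :
    Tendsto (fun R : ℝ => ∫ t in Δ ∩ Set.Icc (-R) R, f t) atTop (𝓝 (∫ t in Δ, f t)) := by
  have h := (aecover_Icc (μ := volume.restrict Δ) tendsto_neg_atTop_atBot
    tendsto_id).integral_tendsto_of_countably_generated hf
  simpa only [Measure.restrict_restrict measurableSet_Icc, Set.inter_comm, id] using h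

/-- For a nonnegative integrand the truncated integrals are those of the norm, so their convergence
already forces integrability. -/
theorem IsOrthogonalitySet.integrableOn_conjPoly_mul_of_tendsto
    (hΔ : IsOrthogonalitySet n α β Δ) (f : ℂ[X]) {L : ℂ}
    (h : Tendsto (fun R : ℝ => ∫ t in Δ ∩ Set.Icc (-R) R, jacobiWeighted α β (conjPoly f * f) t)
      atTop (𝓝 L)) : IntegrableOn (jacobiWeighted α β (conjPoly f * f)) Δ := by
  have hcov : AECover (volume.restrict Δ) atTop fun R : ℝ => Set.Icc (-R) R :=
    aecover_Icc tendsto_neg_atTop_atBot tendsto_id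
  refine hcov.integrable_of_integral_norm_tendsto L.re (fun R => ?_) ?_
  · rw [IntegrableOn, Measure.restrict_restrict measurableSet_Icc, Set.inter_comm]
    exact hΔ.integrableOn_inter_Icc _ R
  · refine ((Complex.continuous_re.tendsto L).comp h).congr fun R => ?_
    rw [Measure.restrict_restrict measurableSet_Icc, Set.inter_comm, Function.comp]
    have e : ∀ t, ‖jacobiWeighted α β (conjPoly f * f) t‖ =
        ‖f.eval (t : ℂ)‖ ^ 2 * jacobiAbsWeight α β t := by
      intro t
      rw [jacobiWeighted_conjPoly_mul, Complex.norm_real, Real.norm_of_nonneg]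
      exact mul_nonneg (sq_nonneg _) (jacobiAbsWeight_nonneg α β t)
    simp only [e]
    simp only [jacobiWeighted_conjPoly_mul]
    rw [integral_complex_ofReal, Complex.ofReal_re]

theorem jacobiWeighted_C_mul_add_mul (α β : ℝ) (a : ℂ) (A r p : ℂ[X]) (t : ℝ) :
    jacobiWeighted α β ((C a * A + r) * p) t =
      a * jacobiWeighted α β (A * p) t + jacobiWeighted α β (r * p) t := by
  simp only [jacobiWeighted, eval_mul, eval_add, eval_C]
  ring

theorem IsOrthogonalitySet.integrableOn_mul (hΔ : IsOrthogonalitySet n α β Δ) {q p : ℂ[X]}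
    (hq : q.degree < n) (hp : p.degree ≤ n) : IntegrableOn (jacobiWeighted α β (q * p)) Δ := by
  rcases eq_or_ne q 0 with rfl | h0
  · have : jacobiWeighted α β (0 * p) = 0 := by ext t; simp [jacobiWeighted]
    rw [this]
    exact integrableOn_zero
  · have h1 : q.natDegree < n := (natDegree_lt_iff_degree_lt h0).2 hq
    have h2 : (q * p).natDegree ≤ q.natDegree + n :=
      natDegree_mul_le_of_le le_rfl (natDegree_le_iff_degree_le.2 hp)
    exact hΔ.integrableOn_of_natDegree_lt _ (by omega)

end OrthogonalitySets

/-! ### Assembly of the main theorem -/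

theorem corollary5p2 (n : ℕ) (α β : ℝ)
    (hα : ∀ m : ℤ, α ≠ (m : ℝ)) (hβ : ∀ m : ℤ, β ≠ (m : ℝ))
    (hαβ : ∀ m : ℤ, α + β ≠ (m : ℝ))
    (Δ : Set ℝ) (hΔ : IsOrthogonalitySet n α β Δ)
    (w : ℝ → ℂ) (hw : IsJacobiWeightBranch α β Δ w) :
    (jacobiP n α β).degree = (n : WithBot ℕ) ∧
    (∀ q : ℂ[X], q.degree < (n : WithBot ℕ) →
      IntegrableOn (orthIntegrand w q (jacobiP n α β)) Δ ∧
        ∫ t in Δ, orthIntegrand w q (jacobiP n α β) t = 0) ∧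
    (∀ q : ℂ[X], q.degree = (n : WithBot ℕ) →
      (Δ = Set.Icc (-1) 1 ∨ 2 * (n : ℝ) + α + β < -1) →
      IntegrableOn (orthIntegrand w q (jacobiP n α β)) Δ ∧
        ∫ t in Δ, orthIntegrand w q (jacobiP n α β) t ≠ 0) ∧
    (∀ q : ℂ[X], q.degree = (n : WithBot ℕ) →
      Δ ≠ Set.Icc (-1) 1 → -1 < 2 * (n : ℝ) + α + β →
      IntegralDiverges (orthIntegrand w q (jacobiP n α β)) Δ) ∧
    (∀ p : ℂ[X], p.degree ≤ (n : WithBot ℕ) →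
      ((∀ q : ℂ[X], q.degree < (n : WithBot ℕ) →
          IntegrableOn (orthIntegrand w q p) Δ ∧ ∫ t in Δ, orthIntegrand w q p t = 0) ↔
        ∃ c : ℂ, p = C c * jacobiP n α β)) := by
  obtain ⟨c, hc0, hc⟩ := hΔ.exists_ae_eq hw
  set P := jacobiP n α β with hP
  have hPdeg : P.degree = n := degree_jacobiP n fun m hm => hαβ m (by exact_mod_cast hm)
  have hPnat : P.natDegree = n := natDegree_eq_of_degree_eq_some hPdeg
  have hP0 : P ≠ 0 := by rintro h; rw [h, degree_zero] at hPdeg; exact absurd hPdeg (by simp)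
  have hcPdeg : (conjPoly P).degree = n := by rw [degree_conjPoly, hPdeg]
  have hcP0 : conjPoly P ≠ 0 := by
    intro h; rw [h, degree_zero] at hcPdeg; exact absurd hcPdeg (by simp)
  have hPP : (conjPoly P * P).natDegree = 2 * n := by
    rw [natDegree_mul hcP0 hP0, natDegree_conjPoly, hPnat, two_mul]
  have hIint : ∀ q p : ℂ[X], IntegrableOn (jacobiWeighted α β (q * p)) Δ →
      IntegrableOn (orthIntegrand w q p) Δ := fun q p h =>
    (Integrable.const_mul h c).congr (hc q p).symm
  have hIeq : ∀ q p : ℂ[X], ∫ t in Δ, orthIntegrand w q p t =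
      c * ∫ t in Δ, jacobiWeighted α β (q * p) t := fun q p => by
    rw [integral_congr_ae (hc q p), integral_const_mul]
  have horth : ∀ q : ℂ[X], q.degree < n → ∫ t in Δ, jacobiWeighted α β (q * P) t = 0 :=
    fun q hq => hΔ.integral_mul_jacobiP hq
  refine ⟨hPdeg, fun q hq => ⟨hIint q P (hΔ.integrableOn_mul hq hPdeg.le), ?_⟩,
    fun q hq hcase => ?_, fun q hq hne hlow => ?_, fun p hp => ⟨fun h => ?_, ?_⟩⟩
  · rw [hIeq, horth q hq, mul_zero]
  -- Expanding along `conjPoly P` rather than `P` makes the leading part of `q * P` equal to `a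
  -- |P|²` on the real line.
  · obtain ⟨a, r, rfl, hr⟩ := exists_eq_C_mul_add hcPdeg hq.le
    have ha : a ≠ 0 := by
      rintro rfl
      rw [C_0, zero_mul, zero_add] at hq
      exact hr.ne hq
    have i1 : IntegrableOn (jacobiWeighted α β (conjPoly P * P)) Δ :=
      hΔ.integrableOn _ (by rw [hPP]; push_cast; exact hcase)
    have i2 := hΔ.integrableOn_mul hr hPdeg.le
    have e : jacobiWeighted α β ((C a * conjPoly P + r) * P) = fun t =>
        a * jacobiWeighted α β (conjPoly P * P) t + jacobiWeighted α β (r * P) t :=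
      funext fun t => jacobiWeighted_C_mul_add_mul α β a _ r P t
    refine ⟨hIint _ _ ?_, ?_⟩
    · rw [e]
      exact (Integrable.const_mul i1 a).add i2
    · rw [hIeq, e, integral_add (Integrable.const_mul i1 a) i2, integral_const_mul, horth r hr,
        add_zero]
      exact mul_ne_zero hc0 (mul_ne_zero ha (hΔ.integral_conjPoly_mul_ne_zero hP0 i1))
  · obtain ⟨a, r, rfl, hr⟩ := exists_eq_C_mul_add hcPdeg hq.le
    have ha : a ≠ 0 := by
      rintro rfl
      rw [C_0, zero_mul, zero_add] at hq
      exact hr.ne hq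
    have hnot : ¬ ∃ L : ℂ, Tendsto (fun R : ℝ => ∫ t in Δ ∩ Set.Icc (-R) R,
        orthIntegrand w (C a * conjPoly P + r) P t) atTop (𝓝 L) := by
      rintro ⟨L, hL⟩
      have h1 := tendsto_integral_inter_Icc (hΔ.integrableOn_mul hr hPdeg.le)
      -- Solving for the truncated integrals of `|P|²`: a limit for `q` would give them one as well.
      have h2 := ((hL.const_mul c⁻¹).sub h1).const_mul a⁻¹
      refine hΔ.not_integrableOn hne (mul_ne_zero hcP0 hP0) ?_
        (hΔ.integrableOn_conjPoly_mul_of_tendsto P (h2.congr fun R => ?_))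
      · rw [hPP]; push_cast; exact hlow.le
      · rw [integral_congr_ae (ae_mono (Measure.restrict_mono_set _ Set.inter_subset_left)
          (hc (C a * conjPoly P + r) P)), integral_const_mul]
        simp only [jacobiWeighted_C_mul_add_mul]
        rw [integral_add (Integrable.const_mul (hΔ.integrableOn_inter_Icc _ R) a)
          (hΔ.integrableOn_inter_Icc _ R), integral_const_mul, inv_mul_cancel_left₀ hc0,
          add_sub_cancel_right, inv_mul_cancel_left₀ ha]
    exact ⟨fun h => hnot ⟨_, tendsto_integral_inter_Icc h⟩, hnot⟩
  · obtain ⟨a, r, rfl, hr⟩ := exists_eq_C_mul_add hPdeg hp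
    -- Testing against `conj r` kills the `P` component by orthogonality and leaves `∫ |r|² = 0`, so
    -- `r = 0`.
    have hcr : (conjPoly r).degree < n := by rwa [degree_conjPoly]
    have h1 := (h (conjPoly r) hcr).2
    rw [hIeq] at h1
    have h2 := (mul_eq_zero.1 h1).resolve_left hc0
    have i1 := hΔ.integrableOn_mul hcr hPdeg.le
    have i2 := hΔ.integrableOn_mul hcr hr.le
    rw [mul_comm] at h2
    simp only [jacobiWeighted_C_mul_add_mul] at h2
    simp only [mul_comm P, mul_comm r] at h2
    rw [integral_add (Integrable.const_mul i1 a) i2, integral_const_mul, horth _ hcr, mul_zero,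
      zero_add] at h2
    refine ⟨a, ?_⟩
    by_contra hne
    refine hΔ.integral_conjPoly_mul_ne_zero (f := r) (fun h0 => hne ?_) i2 h2
    rw [h0, add_zero]
  · rintro ⟨d, rfl⟩ q hq
    have i := hΔ.integrableOn_mul hq hp
    refine ⟨hIint _ _ i, ?_⟩
    have e : ∀ t, jacobiWeighted α β (q * (C d * P)) t = d * jacobiWeighted α β (q * P) t := by
      intro t
      simp only [jacobiWeighted, eval_mul, eval_C]
      ring
    rw [hIeq]
    simp only [e]
    rw [integral_const_mul, horth q hq, mul_zero, mul_zero]
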